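/- Let $s\ge 2$. Let $\mathcal P_s=SO(s)\backslash SL(s,\mathbb R)$ be the space of positive definite quadratic forms of determinant one on $\mathbb R^s$ (the coset $SO(s)Y$ corresponds to the form with matrix $Y^TY$), with the distance $d(Q_1,Q_2)=\sqrt{\sum_{i}(\ln\lambda_i)^2}$, where $\lambda_1,\dots,\lambda_s$ are the coefficients of $Q_2$ in a $Q_1$-orthonormal basis that diagonalizes $Q_2$. Let $\mathcal T_s=\mathcal P_s/SL(s,\mathbb Z)$, where $B\in SL(s,\mathbb Z)$ acts by $Q\mapsto Q\circ B$, with the quotient distance, and let $\mathrm{proj}:\mathcal P_s\to\mathcal T_s$ be the projection. For $1\le i\le s-1$ let $r_i$ be the ray $$r_i(t)=\mathrm{diag}(\underbrace{e^{\lambda_i t},\dots,e^{\lambda_i t}}_{s-i},\underbrace{e^{-\mu_i t},\dots,e^{-\mu_i t}}_{i}),\quad t\ge 0,\qquad \lambda_i=\sqrt{\tfrac{i}{s(s-i)}},\quad \mu_i=\sqrt{\tfrac{s-i}{si}},$$ in $\mathcal P_s$, and let $\bar r_i=\mathrm{proj}\circ r_i$. For $i\in\{1,s-1\}$ the Busemann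 function $\bar f_i(x)=\lim_{t\to\infty}\left[d(x,\bar r_i(t))-t\right]$ is well defined (the limit exists and is finite) at every $x\in\mathcal T_s$, and there is a constant $C$, depending only on $s$, such that for all $x\in\mathcal T_s$ $$(s-1)\,\bar f_{s-1}(x)-C\;\le\;\bar f_1(x)\;\le\;\frac{1}{s-1}\,\bar f_{s-1}(x)+C .$$ In terms of lattices, for every $g\in SL(s,\mathbb R)$, with $\Lambda=g\mathbb Z^s$ and $x$ the class of $g$ in $\mathcal T_s$, $$\bar f_1(x)=2\sqrt{\tfrac{s}{s-1}}\,\ln m(\Lambda),\qquad \bar f_{s-1}(x)=2\sqrt{\tfrac{s}{s-1}}\,\ln c(\Lambda),$$ where $m(\Lambda)$ is the minimum of the Euclidean norms of the non-zero vectors of $\Lambda$, and $c(\Lambda)$ is the minimum of the Euclidean covolumes of the subgroups of $\Lambda$ that are lattices in a hyperplane of $\mathbb R^s$; both minima are attained and positive. -/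

import Mathlib

open Filter Topology
open scoped Matrix MatrixGroups

namespace LocSym

/-- The symmetric space `𝒫_s = SO(s) \ SL(s, ℝ)`: positive definite quadratic forms of
determinant one on `ℝ^s`, given by their matrices in the canonical basis. The coset `SO(s) Y`
corresponds to the form with matrix `Yᵀ Y`, see `PosForm.ofSL_surjective` and `PosForm.ofSL_eq_iff` below. -/
def PosForm (s : ℕ) : Type :=
  {M : Matrix (Fin s) (Fin s) ℝ // M.PosDef ∧ M.det = 1}

/-- The right action `Q ↦ Q ∘ g`, in matrices `M ↦ gᵀ M g`, of `SL(s, ℝ)` on `𝒫_s`. -/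
def PosForm.act {s : ℕ} (Q : PosForm s) (g : SL(s, ℝ)) : PosForm s :=
  ⟨(g : Matrix (Fin s) (Fin s) ℝ)ᵀ * Q.1 * (g : Matrix (Fin s) (Fin s) ℝ), by
    have hu : IsUnit (g : Matrix (Fin s) (Fin s) ℝ) := by
      rw [Matrix.isUnit_iff_isUnit_det, g.2]; exact isUnit_one
    have := Q.2.1.conjTranspose_mul_mul_same (B := (g : Matrix (Fin s) (Fin s) ℝ))
      (Matrix.mulVec_injective_of_isUnit hu)
    rwa [Matrix.conjTranspose_eq_transpose_of_trivial] at this, by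
    rw [Matrix.det_mul, Matrix.det_mul, Matrix.det_transpose, g.2, Q.2.2]; norm_num⟩

/-- The form with matrix `gᵀ g`, i.e. `v ↦ ‖g v‖²`. -/
def PosForm.ofSL {s : ℕ} (g : SL(s, ℝ)) : PosForm s :=
  PosForm.act ⟨1, Matrix.PosDef.one, Matrix.det_one⟩ g

open scoped MatrixOrder in
/-- Every form in `𝒫_s` is of the form `gᵀ g` with `g ∈ SL(s, ℝ)`. -/
theorem PosForm.ofSL_surjective {s : ℕ} (hs : 1 ≤ s) :
    Function.Surjective (PosForm.ofSL : SL(s, ℝ) → PosForm s) := by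
  rintro ⟨M, hM, hd⟩
  obtain ⟨B, rfl⟩ := CStarAlgebra.nonneg_iff_eq_star_mul_self.mp hM.posSemidef.nonneg
  rw [Matrix.star_eq_conjTranspose, Matrix.conjTranspose_eq_transpose_of_trivial, Matrix.det_mul, Matrix.det_transpose] at hd
  let e : Fin s → ℝ := fun j => if j = ⟨0, hs⟩ then B.det else 1
  have hE : (Matrix.diagonal e).det = B.det := by
    rw [Matrix.det_diagonal]
    simp [e]
  have hE2 : Matrix.diagonal e * Matrix.diagonal e = 1 := by
    rw [Matrix.diagonal_mul_diagonal, ← Matrix.diagonal_one]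
    congr 1
    funext j
    by_cases hj : j = ⟨0, hs⟩
    · simpa [e, hj] using hd
    · simp [e, hj]
  refine ⟨⟨Matrix.diagonal e * B, by rw [Matrix.det_mul, hE, hd]⟩, Subtype.ext ?_⟩
  simp only [PosForm.ofSL, PosForm.act, Matrix.transpose_mul, Matrix.diagonal_transpose, mul_one]
  rw [Matrix.mul_assoc, ← Matrix.mul_assoc (Matrix.diagonal e), hE2, one_mul,
    Matrix.star_eq_conjTranspose, Matrix.conjTranspose_eq_transpose_of_trivial]

/-- Two elements of `SL(s, ℝ)` define the same form if and only if they are in the same right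
coset of `SO(s)`. -/
theorem PosForm.ofSL_eq_iff {s : ℕ} (g h : SL(s, ℝ)) :
    PosForm.ofSL g = PosForm.ofSL h ↔ ∃ k : SL(s, ℝ),
      (k : Matrix (Fin s) (Fin s) ℝ)ᵀ * (k : Matrix (Fin s) (Fin s) ℝ) = 1 ∧ g = k * h := by
  have hform : ∀ a : SL(s, ℝ), (PosForm.ofSL a).1 =
      (a : Matrix (Fin s) (Fin s) ℝ)ᵀ * (a : Matrix (Fin s) (Fin s) ℝ) := by
    intro a
    simp [PosForm.ofSL, PosForm.act]
  constructor
  · intro H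
    have H1 : (g : Matrix (Fin s) (Fin s) ℝ)ᵀ * (g : Matrix (Fin s) (Fin s) ℝ) =
        (h : Matrix (Fin s) (Fin s) ℝ)ᵀ * (h : Matrix (Fin s) (Fin s) ℝ) := by
      rw [← hform, ← hform, H]
    refine ⟨g * h⁻¹, ?_, by simp⟩
    have hh : (h : Matrix (Fin s) (Fin s) ℝ) * ((h⁻¹ : SL(s, ℝ)) : Matrix (Fin s) (Fin s) ℝ) = 1 := by
      rw [← Matrix.SpecialLinearGroup.coe_mul, mul_inv_cancel, Matrix.SpecialLinearGroup.coe_one]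
    rw [Matrix.SpecialLinearGroup.coe_mul, Matrix.transpose_mul, Matrix.mul_assoc,
      ← Matrix.mul_assoc _ (g : Matrix (Fin s) (Fin s) ℝ), H1, Matrix.mul_assoc, hh, mul_one,
      ← Matrix.transpose_mul, hh, Matrix.transpose_one]
  · rintro ⟨k, hk, rfl⟩
    apply Subtype.ext
    rw [hform, hform, Matrix.SpecialLinearGroup.coe_mul, Matrix.transpose_mul, Matrix.mul_assoc,
      ← Matrix.mul_assoc _ (k : Matrix (Fin s) (Fin s) ℝ), hk, one_mul]

/-- The distance on `𝒫_s`: `√(∑ (ln λ_i)²)`, where `λ_1, …, λ_s` are the eigenvalues, with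
multiplicity, of `Q₂` relative to `Q₁`, i.e. the roots of the characteristic polynomial of
`M₁⁻¹ M₂`. By `PosForm.dist_eq` below, these are the diagonal coefficients of `Q₂` in any
`Q₁`-orthonormal basis that diagonalizes `Q₂`. -/
noncomputable def PosForm.dist {s : ℕ} (Q₁ Q₂ : PosForm s) : ℝ :=
  Real.sqrt (((Q₁.1⁻¹ * Q₂.1).charpoly.roots.map fun x => Real.log x ^ 2).sum)

/-- If the columns of `P` are a `Q₁`-orthonormal basis in which `Q₂` is diagonal with
coefficients `l i`, then the distance is `√(∑ (ln (l i))²)`. -/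
theorem PosForm.dist_eq {s : ℕ} (Q₁ Q₂ : PosForm s) (P : Matrix (Fin s) (Fin s) ℝ)
    (l : Fin s → ℝ) (h₁ : Pᵀ * Q₁.1 * P = 1) (h₂ : Pᵀ * Q₂.1 * P = Matrix.diagonal l) :
    PosForm.dist Q₁ Q₂ = Real.sqrt (∑ i, Real.log (l i) ^ 2) := by
  have hP : (Pᵀ * Q₁.1) * P = 1 := h₁
  have hP' : P * (Pᵀ * Q₁.1) = 1 := mul_eq_one_comm.mp hP
  have hinv : Q₁.1⁻¹ = P * Pᵀ := by
    apply Matrix.inv_eq_left_inv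
    rw [Matrix.mul_assoc]; exact hP'
  have key : (Q₁.1⁻¹ * Q₂.1).charpoly = (Matrix.diagonal l).charpoly := by
    rw [hinv, Matrix.mul_assoc, Matrix.charpoly_mul_comm, h₂]
  have hroots : (Matrix.diagonal l).charpoly.roots = Finset.univ.val.map l := by
    rw [Matrix.charpoly_diagonal,
      ← Polynomial.roots_multiset_prod_X_sub_C (Finset.univ.val.map l), Multiset.map_map]
    rfl
  unfold PosForm.dist
  rw [key, hroots, Multiset.map_map]
  rfl

/-- `Q₁ ≃ Q₂` if and only if `Q₁ = Q₂ ∘ γ` for some `γ ∈ SL(s, ℤ)`. -/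
def PosForm.intSetoid (s : ℕ) : Setoid (PosForm s) where
  r Q₁ Q₂ := ∃ γ : SL(s, ℤ), Q₁ = Q₂.act (Matrix.SpecialLinearGroup.map (Int.castRingHom ℝ) γ)
  iseqv := by
    have hmul : ∀ (Q : PosForm s) (g h : SL(s, ℝ)), (Q.act g).act h = Q.act (g * h) := by
      intro Q g h
      apply Subtype.ext
      simp [PosForm.act, Matrix.mul_assoc, Matrix.transpose_mul]
    have hone : ∀ Q : PosForm s, Q.act 1 = Q := by
      intro Q
      apply Subtype.ext
      simp [PosForm.act]
    refine ⟨fun Q => ⟨1, by rw [map_one, hone]⟩, ?_, ?_⟩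
    · rintro Q R ⟨γ, h⟩
      exact ⟨γ⁻¹, by rw [h, hmul, ← map_mul, mul_inv_cancel, map_one, hone]⟩
    · rintro Q R S ⟨γ, h⟩ ⟨δ, h'⟩
      exact ⟨δ * γ, by rw [h, h', hmul, ← map_mul]⟩

/-- The locally symmetric space `𝒯_s = 𝒫_s / SL(s, ℤ) = SO(s) \ SL(s, ℝ) / SL(s, ℤ)`. -/
def LocSymSpace (s : ℕ) : Type :=
  Quotient (PosForm.intSetoid s)

/-- The projection `𝒫_s → 𝒯_s`. -/
def proj {s : ℕ} (Q : PosForm s) : LocSymSpace s :=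
  Quotient.mk (PosForm.intSetoid s) Q

/-- The quotient distance on `𝒯_s`: the infimum of the distances between representatives. -/
noncomputable def LocSymSpace.dist {s : ℕ} (x y : LocSymSpace s) : ℝ :=
  sInf {d : ℝ | ∃ Q R : PosForm s, proj Q = x ∧ proj R = y ∧ d = PosForm.dist Q R}

/-- The singular ray `r_i`, `1 ≤ i ≤ s - 1`, of the Weyl chamber `W_0` (the diagonal forms with
decreasing coefficients), parametrized by arc length `t ≥ 0`: the diagonal form with coefficients
`e^{λ t}` (`s - i` times) and then `e^{-μ t}` (`i` times), with `λ = √(i / (s (s - i)))` and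
`μ = √((s - i) / (s i))`. -/
noncomputable def singularRay (s i : ℕ) (h0 : 1 ≤ i) (h1 : i < s) (t : ℝ) : PosForm s :=
  ⟨Matrix.diagonal fun j : Fin s =>
      if (j : ℕ) < s - i then Real.exp (Real.sqrt ((i : ℝ) / (s * ((s : ℝ) - i))) * t)
      else Real.exp (-Real.sqrt (((s : ℝ) - i) / (s * i)) * t), by
    refine ⟨Matrix.PosDef.diagonal fun j => ?_, ?_⟩
    · split_ifs <;> exact Real.exp_pos _
    · have hi : (0 : ℝ) < i := by exact_mod_cast h0
      have hsi : (0 : ℝ) < (s : ℝ) - i := by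
        have : (i : ℝ) < s := by exact_mod_cast h1
        linarith
      have hs : (0 : ℝ) < s := by linarith
      have hA : Real.sqrt ((i : ℝ) / (s * ((s : ℝ) - i))) * ((s : ℝ) - i)
          = Real.sqrt (((s : ℝ) - i) / (s * i)) * i := by
        have key : ∀ x y : ℝ, 0 < y → Real.sqrt x * y = Real.sqrt (x * y ^ 2) := by
          intro x y hy
          rw [Real.sqrt_mul' _ (sq_nonneg y), Real.sqrt_sq hy.le]
        rw [key _ _ hsi, key _ _ hi]
        congr 1
        field_simp
      rw [Matrix.det_diagonal, Finset.prod_ite, Finset.prod_const, Finset.prod_const,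
        ← Real.exp_nat_mul, ← Real.exp_nat_mul, ← Real.exp_add]
      have c1 : (Finset.univ.filter fun j : Fin s => (j : ℕ) < s - i).card = s - i := by
        rw [Fin.card_filter_val_lt]; omega
      have c2 : (Finset.univ.filter fun j : Fin s => ¬ (j : ℕ) < s - i).card = i := by
        have := Finset.card_filter_add_card_filter_not (s := (Finset.univ : Finset (Fin s)))
          (fun j : Fin s => (j : ℕ) < s - i)
        rw [c1, Finset.card_univ, Fintype.card_fin] at this
        omega
      rw [c1, c2, Nat.cast_sub h1.le, Real.exp_eq_one_iff]
      linear_combination t * hA⟩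

/-- The Busemann function `f_r(x) = lim_{t → ∞} (d(x, r(t)) - t)` of a ray `r` in a space `X`
with distance `d`. -/
noncomputable def busemann {X : Type*} (d : X → X → ℝ) (r : ℝ → X) (x : X) : ℝ :=
  limUnder atTop fun t : ℝ => d x (r t) - t

/-- The projection `r̄_i` to `𝒯_s` of the singular ray `r_i`. -/
noncomputable def projRay (s i : ℕ) (h0 : 1 ≤ i) (h1 : i < s) (t : ℝ) : LocSymSpace s :=
  proj (singularRay s i h0 h1 t)

/-- The Busemann function `f̄_i` on `𝒯_s` of the ray `r̄_i`. -/
noncomputable def fbar (s i : ℕ) (h0 : 1 ≤ i) (h1 : i < s) (x : LocSymSpace s) : ℝ :=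
  busemann LocSymSpace.dist (projRay s i h0 h1) x

/-- The lattice `g ℤ^s` of covolume one in Euclidean space. -/
def lattice {s : ℕ} (g : SL(s, ℝ)) : Set (EuclideanSpace ℝ (Fin s)) :=
  {w | ∃ v : Fin s → ℤ,
    w = WithLp.toLp 2 ((g : Matrix (Fin s) (Fin s) ℝ) *ᵥ fun j => (v j : ℝ))}

/-- The norms of the non-zero vectors of a subset of `ℝ^s`. -/
def nonzeroNorms {s : ℕ} (L : Set (EuclideanSpace ℝ (Fin s))) : Set ℝ :=
  {a | ∃ w ∈ L, w ≠ 0 ∧ a = ‖w‖}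

/-- The Euclidean covolumes of the subgroups of a lattice `L` of `ℝ^s` that are lattices in a
hyperplane: such a subgroup is generated by `s - 1` linearly independent vectors of `L`, and its
covolume is the square root of the determinant of their Gram matrix. -/
noncomputable def hyperplaneCovolumes {s : ℕ} (L : Set (EuclideanSpace ℝ (Fin s))) : Set ℝ :=
  {a | ∃ w : Fin (s - 1) → EuclideanSpace ℝ (Fin s), (∀ i, w i ∈ L) ∧ LinearIndependent ℝ w ∧
    a = Real.sqrt (Matrix.gram ℝ w).det}

end LocSym

/-! Write `a = 1 / √(s (s - 1))`, and let `spike k t` be the diagonal form with coefficient `exp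
(-(s - 1) a t)` at `k` and `exp (a t)` elsewhere. In `𝒫_s` its Busemann function is `s a log (Q k
k)`. Relative to this form, `Q` has logarithmic eigenvalues with zero sum, one near `(s - 1) a t +
log (Q k k)` and the others within a bounded distance of `-a t`; the Euclidean norm of such a vector
is `t + s a log (Q k k) + o(1)` (`tendsto_dist_spike_sub`). The bound `t + s a log (Q k k) ≤ d(Q,
spike k t)` holds for every `t` without error term (`add_log_le_dist_spike`).

Passing to `𝒯_s` replaces `Q` by the forms `Q ∘ γ`. As the lower bound is uniform in `γ`, the limit
becomes `s a log μ(Q)`, where `μ(Q)` is the least value of `(Q ∘ γ) k k`, that is, the minimum of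
`Q` over non-zero integer vectors (`tendsto_dist_proj_spike_sub`).

The ray `r_1` is a spike, and `r_{s-1}` is the inverse of one. Inversion induces an isometry of
`𝒯_s`, so `f̄_1 = s a log μ(Q)` and `f̄_{s-1} = s a log μ(Q⁻¹)`. The comparison is then the
inequality `μ(Q)^(s-1) ≤ (s-1)^(s-1) μ(Q⁻¹)`, used for `Q` and for `Q⁻¹`. It is Minkowski's theorem
on the sublattice orthogonal to a minimal vector of `Q⁻¹`, on which `Q` has determinant `μ(Q⁻¹)`
(`minVal_pow_le`). The same duality between hyperplane sublattices and dual vectors gives the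
covolume formula (`det_gram_eq_intVal_inv`). -/

namespace LocSym

/-! ### Relative eigenvalues and isometries of `𝒫_s`. -/

namespace PosForm

variable {s : ℕ}

theorem act_act (Q : PosForm s) (g h : SL(s, ℝ)) : (Q.act g).act h = Q.act (g * h) := by
  apply Subtype.ext
  simp [act, Matrix.mul_assoc, Matrix.transpose_mul]

theorem act_one (Q : PosForm s) : Q.act 1 = Q := by
  apply Subtype.ext
  simp [act]

theorem dist_nonneg (Q R : PosForm s) : 0 ≤ dist Q R := Real.sqrt_nonneg _

/-- The dual form, with the inverse matrix. -/
noncomputable def inv (Q : PosForm s) : PosForm s :=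
  ⟨Q.1⁻¹, Q.2.1.inv, by simp [Matrix.det_nonsing_inv, Q.2.2]⟩

theorem isUnit_det (Q : PosForm s) : IsUnit Q.1.det := by simp [Q.2.2]

theorem inv_inv (Q : PosForm s) : Q.inv.inv = Q :=
  Subtype.ext (Matrix.nonsing_inv_nonsing_inv _ Q.isUnit_det)

theorem inv_val_eq_adjugate (Q : PosForm s) : Q.inv.1 = Q.1.adjugate := by
  simp [inv, Matrix.inv_def, Q.2.2]

theorem inv_act (Q : PosForm s) (g : SL(s, ℝ)) :
    (Q.act g).inv = Q.inv.act g⁻¹.transpose := by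
  apply Subtype.ext
  have hg : ((g : Matrix (Fin s) (Fin s) ℝ))⁻¹ = ((g⁻¹ : SL(s, ℝ)) : Matrix (Fin s) (Fin s) ℝ) := by
    apply Matrix.inv_eq_left_inv
    rw [← Matrix.SpecialLinearGroup.coe_mul, inv_mul_cancel, Matrix.SpecialLinearGroup.coe_one]
  change (((g : Matrix (Fin s) (Fin s) ℝ))ᵀ * Q.1 * (g : Matrix (Fin s) (Fin s) ℝ))⁻¹ =
    (((g⁻¹ : SL(s, ℝ)) : Matrix (Fin s) (Fin s) ℝ)ᵀ)ᵀ * Q.1⁻¹ *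
      ((g⁻¹ : SL(s, ℝ)) : Matrix (Fin s) (Fin s) ℝ)ᵀ
  rw [Matrix.mul_inv_rev, Matrix.mul_inv_rev, ← Matrix.transpose_nonsing_inv, hg,
    Matrix.transpose_transpose, Matrix.mul_assoc]

/-- Simultaneous diagonalization of two forms of determinant one. -/
theorem exists_simultaneous_diagonalization (hs : 1 ≤ s) (Q R : PosForm s) :
    ∃ (P : Matrix (Fin s) (Fin s) ℝ) (l : Fin s → ℝ), Pᵀ * Q.1 * P = 1 ∧
      Pᵀ * R.1 * P = Matrix.diagonal l ∧ (∀ i, 0 < l i) ∧ ∏ i, l i = 1 := by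
  obtain ⟨g, rfl⟩ := ofSL_surjective hs Q
  have hM := (R.act g⁻¹).2.1
  have hd := (R.act g⁻¹).2.2
  have hU := Matrix.mem_unitaryGroup_iff'.mp hM.1.eigenvectorUnitary.2
  have hU' := hM.1.conjStarAlgAut_star_eigenvectorUnitary
  rw [Unitary.conjStarAlgAut_star_apply] at hU'
  set U : Matrix (Fin s) (Fin s) ℝ := hM.1.eigenvectorUnitary.1 with hUdef
  rw [Matrix.star_eq_conjTranspose, Matrix.conjTranspose_eq_transpose_of_trivial] at hU hU'
  have hg : (g : Matrix (Fin s) (Fin s) ℝ) * ((g⁻¹ : SL(s, ℝ)) : Matrix (Fin s) (Fin s) ℝ) = 1 := by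
    rw [← Matrix.SpecialLinearGroup.coe_mul, mul_inv_cancel, Matrix.SpecialLinearGroup.coe_one]
  refine ⟨((g⁻¹ : SL(s, ℝ)) : Matrix (Fin s) (Fin s) ℝ) * U, hM.1.eigenvalues, ?_, ?_,
    hM.eigenvalues_pos, ?_⟩
  · have h1 : (ofSL g).1 = (g : Matrix (Fin s) (Fin s) ℝ)ᵀ * g := by simp [ofSL, act]
    have h2 : ((g⁻¹ : SL(s, ℝ)) : Matrix (Fin s) (Fin s) ℝ)ᵀ *
        (g : Matrix (Fin s) (Fin s) ℝ)ᵀ = 1 := by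
      rw [← Matrix.transpose_mul, hg, Matrix.transpose_one]
    rw [h1, Matrix.transpose_mul]
    calc _ = Uᵀ * (((g⁻¹ : SL(s, ℝ)) : Matrix (Fin s) (Fin s) ℝ)ᵀ *
        (g : Matrix (Fin s) (Fin s) ℝ)ᵀ) * ((g : Matrix (Fin s) (Fin s) ℝ) *
        ((g⁻¹ : SL(s, ℝ)) : Matrix (Fin s) (Fin s) ℝ)) * U := by simp only [Matrix.mul_assoc]
      _ = 1 := by rw [h2, hg, mul_one, mul_one, hU]
  · rw [Matrix.transpose_mul]
    simp only [act, Matrix.mul_assoc] at hU' ⊢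
    exact hU'
  · have := hM.1.det_eq_prod_eigenvalues
    rw [hd] at this
    simpa using this.symm

/-- If `P` diagonalizes the pair `Q`, `R`, then `g⁻¹ P` diagonalizes `Q ∘ g`, `R ∘ g` with the same
coefficients. -/
theorem dist_act (hs : 1 ≤ s) (Q R : PosForm s) (g : SL(s, ℝ)) :
    dist (Q.act g) (R.act g) = dist Q R := by
  obtain ⟨P, l, h1, h2, -, -⟩ := exists_simultaneous_diagonalization hs Q R
  have hg : (g : Matrix (Fin s) (Fin s) ℝ) * ((g⁻¹ : SL(s, ℝ)) : Matrix (Fin s) (Fin s) ℝ) = 1 := by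
    rw [← Matrix.SpecialLinearGroup.coe_mul, mul_inv_cancel, Matrix.SpecialLinearGroup.coe_one]
  have hg' : ((g⁻¹ : SL(s, ℝ)) : Matrix (Fin s) (Fin s) ℝ)ᵀ *
      (g : Matrix (Fin s) (Fin s) ℝ)ᵀ = 1 := by
    rw [← Matrix.transpose_mul, hg, Matrix.transpose_one]
  have key : ∀ S : PosForm s, (((g⁻¹ : SL(s, ℝ)) : Matrix (Fin s) (Fin s) ℝ) * P)ᵀ *
      (S.act g).1 * (((g⁻¹ : SL(s, ℝ)) : Matrix (Fin s) (Fin s) ℝ) * P) = Pᵀ * S.1 * P := by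
    intro S
    rw [Matrix.transpose_mul]
    calc _ = Pᵀ * (((g⁻¹ : SL(s, ℝ)) : Matrix (Fin s) (Fin s) ℝ)ᵀ *
        (g : Matrix (Fin s) (Fin s) ℝ)ᵀ) * S.1 * ((g : Matrix (Fin s) (Fin s) ℝ) *
        ((g⁻¹ : SL(s, ℝ)) : Matrix (Fin s) (Fin s) ℝ)) * P := by
          simp only [act, Matrix.mul_assoc]
      _ = _ := by rw [hg, hg', mul_one, mul_one]
  rw [dist_eq Q R P l h1 h2, dist_eq _ _ _ l ((key Q).trans h1) ((key R).trans h2)]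

theorem diagonal_inv_eq {l : Fin s → ℝ} (hl : ∀ i, 0 < l i) :
    (Matrix.diagonal l)⁻¹ = Matrix.diagonal fun i => (l i)⁻¹ := by
  apply Matrix.inv_eq_left_inv
  rw [Matrix.diagonal_mul_diagonal, ← Matrix.diagonal_one]
  congr 1
  funext i
  exact inv_mul_cancel₀ (hl i).ne'

/-- The inverse transpose of a diagonalizing basis diagonalizes the dual forms with inverse
coefficients, and the squared logarithms do not change. -/
theorem dist_inv (hs : 1 ≤ s) (Q R : PosForm s) : dist Q.inv R.inv = dist Q R := by
  obtain ⟨P, l, h1, h2, hl, -⟩ := exists_simultaneous_diagonalization hs Q R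
  have key : ∀ M : Matrix (Fin s) (Fin s) ℝ, P⁻¹ᵀᵀ * M⁻¹ * P⁻¹ᵀ = (Pᵀ * M * P)⁻¹ := by
    intro M
    rw [Matrix.mul_inv_rev, Matrix.mul_inv_rev, Matrix.transpose_transpose,
      Matrix.transpose_nonsing_inv, Matrix.mul_assoc]
  rw [dist_eq Q R P l h1 h2, dist_eq Q.inv R.inv P⁻¹ᵀ (fun i => (l i)⁻¹) ((key _).trans (by rw [h1, inv_one]))
    ((key _).trans (by rw [h2, diagonal_inv_eq hl]))]
  simp [Real.log_inv]

/-- The eigenvalues `exp (-y i)` of `R` relative to `Q`: they compute the distance and the traces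
of `Q⁻¹ R` and `R⁻¹ Q`, and bound the ratio of the values of the two forms at a basis vector. -/
theorem exists_log_eigenvalues (hs : 1 ≤ s) (Q R : PosForm s) :
    ∃ y : Fin s → ℝ, ∑ i, y i = 0 ∧ dist Q R = Real.sqrt (∑ i, y i ^ 2) ∧
      ∑ i, Real.exp (y i) = (R.1⁻¹ * Q.1).trace ∧
      ∑ i, Real.exp (-y i) = (Q.1⁻¹ * R.1).trace ∧
      ∀ k, ∃ i, Q.1 k k ≤ Real.exp (y i) * R.1 k k := by
  obtain ⟨P, l, h1, h2, hl, hprod⟩ := exists_simultaneous_diagonalization hs Q R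
  have hPi : P * (Pᵀ * Q.1) = 1 := mul_eq_one_comm.mp h1
  have hQ : Q.1⁻¹ = P * Pᵀ := Matrix.inv_eq_left_inv (by rw [Matrix.mul_assoc]; exact hPi)
  have hQt : Q.1ᵀ = Q.1 := by
    rw [← Matrix.conjTranspose_eq_transpose_of_trivial]; exact Q.2.1.1
  set N := Pᵀ * Q.1 with hN
  have hNt : Nᵀ * Pᵀ = 1 := by rw [← Matrix.transpose_mul, hPi, Matrix.transpose_one]
  have hNQ : Nᵀ * N = Q.1 := by
    rw [hN, Matrix.transpose_mul, Matrix.transpose_transpose, hQt, Matrix.mul_assoc, hPi, mul_one]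
  have hNR : Nᵀ * Matrix.diagonal l * N = R.1 := by
    rw [← h2]
    calc _ = (Nᵀ * Pᵀ) * R.1 * (P * N) := by simp only [Matrix.mul_assoc]
      _ = _ := by rw [hNt, hPi, one_mul, mul_one]
  have hexp : ∀ i, Real.exp (-Real.log (l i)) = (l i)⁻¹ := fun i => by
    rw [Real.exp_neg, Real.exp_log (hl i)]
  have hQk : ∀ k, Q.1 k k = ∑ i, N i k ^ 2 := by
    intro k
    rw [← hNQ, Matrix.mul_apply]
    simp [sq]
  have hRk : ∀ k, R.1 k k = ∑ i, l i * N i k ^ 2 := by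
    intro k
    rw [← hNR, Matrix.mul_apply]
    simp only [Matrix.mul_diagonal, Matrix.transpose_apply]
    exact Finset.sum_congr rfl fun i _ => by ring
  refine ⟨fun i => -Real.log (l i), ?_, ?_, ?_, ?_, ?_⟩
  · rw [Finset.sum_neg_distrib, ← Real.log_prod fun i _ => (hl i).ne', hprod, Real.log_one, neg_zero]
  · rw [dist_eq Q R P l h1 h2]
    simp
  · simp only [hexp]
    have hR : R.1⁻¹ = P * (Matrix.diagonal l)⁻¹ * Pᵀ := by
      apply Matrix.inv_eq_left_inv
      rw [← h2, Matrix.mul_inv_rev, Matrix.mul_inv_rev]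
      have hPu : IsUnit P.det := Matrix.isUnit_det_of_right_inverse hPi
      have hPtu : IsUnit Pᵀ.det := by rwa [Matrix.det_transpose]
      calc _ = (P * P⁻¹) * R.1⁻¹ * (Pᵀ⁻¹ * Pᵀ) * R.1 := by simp only [Matrix.mul_assoc]
        _ = 1 := by
          rw [Matrix.mul_nonsing_inv _ hPu, Matrix.nonsing_inv_mul _ hPtu, one_mul, mul_one,
            Matrix.nonsing_inv_mul _ R.isUnit_det]
    rw [hR, diagonal_inv_eq hl, Matrix.mul_assoc, Matrix.mul_assoc, Matrix.trace_mul_comm,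
      Matrix.mul_assoc, h1, mul_one, Matrix.trace_diagonal]
  · simp only [neg_neg, Real.exp_log (hl _)]
    rw [hQ, Matrix.mul_assoc, Matrix.trace_mul_comm, h2, Matrix.trace_diagonal]
  · intro k
    have : Nonempty (Fin s) := ⟨⟨0, hs⟩⟩
    -- The smallest `l i` gives the largest exponent: `R k k` is the sum of the `l j * N j k ^ 2`,
    -- hence at least `l i * Q k k`.
    obtain ⟨i, hi⟩ := Finite.exists_min l
    refine ⟨i, ?_⟩
    dsimp only
    rw [hexp, inv_mul_eq_div, le_div_iff₀ (hl i), hQk, hRk, Finset.sum_mul]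
    exact Finset.sum_le_sum fun j _ => by
      rw [mul_comm]; exact mul_le_mul_of_nonneg_right (hi j) (sq_nonneg _)

theorem diag_pos (Q : PosForm s) (k : Fin s) : 0 < Q.1 k k := Q.2.1.diag_pos

end PosForm

/-! ### Asymptotics of the distance to a spike. -/

/-- A coordinate of a vector with zero sum is bounded by the Euclidean norm. -/
theorem sq_coord_le_of_sum_eq_zero {s : ℕ} (hs : 2 ≤ s) {y : Fin s → ℝ} (hy : ∑ i, y i = 0)
    (j : Fin s) : (s : ℝ) * y j ^ 2 ≤ ((s : ℝ) - 1) * ∑ i, y i ^ 2 := by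
  have h1 := Finset.add_sum_erase Finset.univ y (Finset.mem_univ j)
  have h2 := Finset.add_sum_erase Finset.univ (fun i => y i ^ 2) (Finset.mem_univ j)
  -- Cauchy–Schwarz for the `s - 1` other coordinates, whose sum is `-y j`.
  have h3 := sq_sum_le_card_mul_sum_sq (s := Finset.univ.erase j) (f := y)
  rw [Finset.card_erase_of_mem (Finset.mem_univ j), Finset.card_univ, Fintype.card_fin,
    Nat.cast_sub (by omega), Nat.cast_one] at h3
  have h4 : ∑ i ∈ Finset.univ.erase j, y i = -y j := by linarith
  rw [h4] at h3
  rw [← h2]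
  nlinarith

/-- A vector with zero sum, one coordinate of which is about `(s - 1) a t + q` and the others at
most a bounded distance below `- a t`, has Euclidean norm about `t + s a q`. -/
theorem sqrt_sum_sq_le {s : ℕ} {a t q δ B L : ℝ} (ha : 0 < a)
    (ha1 : (s : ℝ) * (s - 1) * a ^ 2 = 1) (hs : 2 ≤ s) (ht : 0 < t) {y : Fin s → ℝ}
    (hy : ∑ i, y i = 0) (hB : 0 ≤ B) (hL : 0 ≤ L) (hlow : ∀ i, -(a * t) - B ≤ y i) (j : Fin s)
    (hj : (s - 1) * a * t + q - L ≤ y j) (hj' : y j ≤ (s - 1) * a * t + q + δ) :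
    Real.sqrt (∑ i, y i ^ 2) ≤ t + s * a * (q + δ) +
      ((|q| + L + |δ|) ^ 2 + s * (s * B + |q| + L) ^ 2) / (2 * t) := by
  have hs' : (2 : ℝ) ≤ s := by exact_mod_cast hs
  set E := Finset.univ.erase j with hE
  have h1 := Finset.add_sum_erase Finset.univ y (Finset.mem_univ j)
  have h2 := Finset.add_sum_erase Finset.univ (fun i => y i ^ 2) (Finset.mem_univ j)
  have hcard : (E.card : ℝ) = s - 1 := by
    rw [hE, Finset.card_erase_of_mem (Finset.mem_univ j), Finset.card_univ, Fintype.card_fin,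
      Nat.cast_sub (by omega), Nat.cast_one]
  set d := y j - ((s - 1) * a * t + q) with hd
  have hyj : y j = (s - 1) * a * t + q + d := by rw [hd]; ring
  have hsumE : ∑ i ∈ E, (y i + a * t) = -(q + d) := by
    rw [Finset.sum_add_distrib, Finset.sum_const, nsmul_eq_mul, hcard]
    linarith
  -- The deviations from `-a t` have bounded sum and are each at least `-B`, so each is also bounded
  -- above.
  have hup : ∀ i ∈ E, (y i + a * t) ^ 2 ≤ (s * B + |q| + L) ^ 2 := by
    intro i hi
    have h3 := Finset.add_sum_erase E (fun i => y i + a * t) hi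
    have h4 : -((E.erase i).card * B) ≤ ∑ i ∈ E.erase i, (y i + a * t) := by
      rw [← mul_neg, ← nsmul_eq_mul]
      exact Finset.card_nsmul_le_sum _ _ _ fun x _ => by linarith [hlow x]
    have h5 : ((E.erase i).card : ℝ) ≤ s := by
      have : (E.erase i).card ≤ s := by
        calc (E.erase i).card ≤ (Finset.univ : Finset (Fin s)).card :=
              Finset.card_le_card (Finset.subset_univ _)
          _ = s := by simp
      exact_mod_cast this
    have h6 : ((E.erase i).card : ℝ) * B ≤ s * B := mul_le_mul_of_nonneg_right h5 hB
    have hq := neg_abs_le q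
    have hq2 := abs_nonneg q
    apply sq_le_sq'
    · have h8 : 1 * B ≤ s * B := mul_le_mul_of_nonneg_right (by linarith) hB
      linarith [hlow i]
    · linarith
  have hsqE : ∑ i ∈ E, (y i + a * t) ^ 2 ≤ s * (s * B + |q| + L) ^ 2 := by
    calc _ ≤ E.card • (s * B + |q| + L) ^ 2 := Finset.sum_le_card_nsmul _ _ _ hup
      _ ≤ _ := by
        rw [nsmul_eq_mul, hcard]
        exact mul_le_mul_of_nonneg_right (by linarith) (sq_nonneg _)
  have hexpand : ∑ i ∈ E, y i ^ 2 = ∑ i ∈ E, (y i + a * t) ^ 2 + 2 * (a * t) * (q + d)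
      + (s - 1) * (a * t) ^ 2 := by
    have : ∀ i ∈ E, y i ^ 2 = (y i + a * t) ^ 2 - 2 * (a * t) * (y i + a * t) + (a * t) ^ 2 :=
      fun i _ => by ring
    rw [Finset.sum_congr rfl this, Finset.sum_add_distrib, Finset.sum_sub_distrib,
      ← Finset.mul_sum, hsumE, Finset.sum_const, nsmul_eq_mul, hcard]
    ring
  have hqd : (q + d) ^ 2 ≤ (|q| + L + |δ|) ^ 2 := by
    apply sq_le_sq'
    · linarith [neg_abs_le q, abs_nonneg δ]
    · linarith [le_abs_self q, le_abs_self δ]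
  set D := (|q| + L + |δ|) ^ 2 + s * (s * B + |q| + L) ^ 2 with hD
  -- The term `D / (2 * t)` absorbs the bounded part of the sum of squares, so that the sum is at
  -- most `t ^ 2 + 2 * t * X ≤ (t + X) ^ 2`.
  set X := s * a * (q + δ) + D / (2 * t) with hX
  have htX : 2 * t * X = 2 * t * (s * a * (q + δ)) + D := by
    rw [hX]; field_simp
  have htot : ∑ i, y i ^ 2 ≤ t ^ 2 + 2 * t * X := by
    rw [← h2, hexpand, htX, hyj]
    have h7 : s * a * t * d ≤ s * a * t * δ :=
      mul_le_mul_of_nonneg_left (by linarith) (by positivity)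
    rw [hD]
    have h8 : ((s : ℝ) - 1) * a * t * ((s - 1) * a * t) + (s - 1) * (a * t) ^ 2 = t ^ 2 := by
      linear_combination t ^ 2 * ha1
    linear_combination 2 * h7 + hqd + hsqE + h8
  have hnn : 0 ≤ ∑ i, y i ^ 2 := Finset.sum_nonneg fun i _ => sq_nonneg _
  have hpos : 0 ≤ t + X := by
    have : 0 ≤ t * (t + 2 * X) := by linear_combination hnn + htot
    have := nonneg_of_mul_nonneg_right this ht
    linarith
  have : t + s * a * (q + δ) + D / (2 * t) = t + X := by rw [hX]; ring
  rw [this]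
  exact Real.sqrt_le_iff.mpr ⟨hpos, by linear_combination htot + sq_nonneg X⟩

/-- The slope `1 / √(s (s - 1))` of the rays with one exceptional coefficient. -/
noncomputable def slope (s : ℕ) : ℝ := Real.sqrt (1 / (s * ((s : ℝ) - 1)))

theorem slope_pos {s : ℕ} (hs : 2 ≤ s) : 0 < slope s := by
  have hs' : (2 : ℝ) ≤ s := by exact_mod_cast hs
  exact Real.sqrt_pos.mpr (one_div_pos.mpr (mul_pos (by linarith) (by linarith)))

theorem slope_sq {s : ℕ} (hs : 2 ≤ s) : (s : ℝ) * (s - 1) * slope s ^ 2 = 1 := by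
  have hs' : (2 : ℝ) ≤ s := by exact_mod_cast hs
  have h : (0 : ℝ) < s * (s - 1) := mul_pos (by linarith) (by linarith)
  rw [slope, Real.sq_sqrt (one_div_pos.mpr h).le, mul_one_div_cancel h.ne']

theorem mul_slope {s : ℕ} (hs : 2 ≤ s) :
    (s : ℝ) * slope s = Real.sqrt ((s : ℝ) / ((s : ℝ) - 1)) := by
  have hs' : (2 : ℝ) ≤ s := by exact_mod_cast hs
  have h1 : (0 : ℝ) < s - 1 := by linarith
  have h := slope_sq hs
  symm
  rw [Real.sqrt_eq_iff_mul_self_eq_of_pos (mul_pos (by linarith) (slope_pos hs)),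
    eq_div_iff h1.ne']
  linear_combination s * h

theorem sub_one_mul_slope {s : ℕ} (hs : 2 ≤ s) :
    ((s : ℝ) - 1) * slope s = Real.sqrt (((s : ℝ) - 1) / s) := by
  have hs' : (2 : ℝ) ≤ s := by exact_mod_cast hs
  have h1 : (0 : ℝ) < s - 1 := by linarith
  have h := slope_sq hs
  symm
  rw [Real.sqrt_eq_iff_mul_self_eq_of_pos (mul_pos h1 (slope_pos hs)),
    eq_div_iff (by linarith)]
  linear_combination (s - 1) * h

/-- The diagonal form with coefficient `exp (-(s - 1) a t)` at `k` and `exp (a t)` elsewhere,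
where `a` is `slope s`. -/
noncomputable def spike {s : ℕ} (hs : 2 ≤ s) (k : Fin s) (t : ℝ) : PosForm s :=
  ⟨Matrix.diagonal fun j =>
      Real.exp (if j = k then -((s - 1) * slope s * t) else slope s * t), by
    refine ⟨Matrix.PosDef.diagonal fun j => Real.exp_pos _, ?_⟩
    rw [Matrix.det_diagonal, ← Real.exp_sum, Real.exp_eq_one_iff,
      ← Finset.add_sum_erase _ _ (Finset.mem_univ k), if_pos rfl,
      Finset.sum_congr rfl fun i hi => if_neg (Finset.ne_of_mem_erase hi), Finset.sum_const,
      Finset.card_erase_of_mem (Finset.mem_univ k), Finset.card_univ, Fintype.card_fin,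
      nsmul_eq_mul, Nat.cast_sub (by omega), Nat.cast_one]
    ring⟩

/-- The values at the `k`-th basis vector force some exponent `y i` to be at least `log (Q k k) + (s
- 1) a t`, and for a vector with zero sum `s a y i` is at most the norm. -/
theorem add_log_le_dist_spike {s : ℕ} (hs : 2 ≤ s) (Q : PosForm s) (k : Fin s) (t : ℝ) :
    t + s * slope s * Real.log (Q.1 k k) ≤ PosForm.dist Q (spike hs k t) := by
  obtain ⟨y, hy, hd, -, -, hk⟩ := PosForm.exists_log_eigenvalues (by omega) Q (spike hs k t)
  obtain ⟨i, hi⟩ := hk k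
  have hs' : (2 : ℝ) ≤ s := by exact_mod_cast hs
  have ha := slope_pos hs
  have ha1 := slope_sq hs
  have h1 : (spike hs k t).1 k k = Real.exp (-((s - 1) * slope s * t)) := by simp [spike]
  rw [h1, ← Real.exp_add] at hi
  have h2 : Real.log (Q.1 k k) ≤ y i + -((s - 1) * slope s * t) :=
    (Real.log_le_iff_le_exp (Q.diag_pos k)).mpr hi
  have h3 : t + s * slope s * Real.log (Q.1 k k) ≤ s * slope s * y i := by
    have := mul_le_mul_of_nonneg_left h2 (by positivity : 0 ≤ s * slope s)
    linear_combination this - t * ha1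
  have h4 : (s * slope s * y i) ^ 2 ≤ ∑ i, y i ^ 2 := by
    have := mul_le_mul_of_nonneg_left (sq_coord_le_of_sum_eq_zero hs hy i)
      (by positivity : 0 ≤ s * slope s ^ 2)
    calc _ = s * slope s ^ 2 * (s * y i ^ 2) := by ring
      _ ≤ _ := this
      _ = ((s : ℝ) * (s - 1) * slope s ^ 2) * ∑ i, y i ^ 2 := by ring
      _ = _ := by rw [ha1, one_mul]
  rw [hd]
  exact h3.trans (Real.le_sqrt_of_sq_le h4)

/-- For the upper bound, the two traces locate the exponents: the trace of `Q⁻¹ * spike` keeps all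
of them above `-a t - B`, and that of `spike⁻¹ * Q` determines the largest. -/
theorem tendsto_dist_spike_sub {s : ℕ} (hs : 2 ≤ s) (Q : PosForm s) (k : Fin s) :
    Tendsto (fun t => PosForm.dist Q (spike hs k t) - t) atTop
      (𝓝 (s * slope s * Real.log (Q.1 k k))) := by
  have hs' : (2 : ℝ) ≤ s := by exact_mod_cast hs
  have ha := slope_pos hs
  have ha1 := slope_sq hs
  set a := slope s with ha_def
  have hQ := Q.diag_pos k
  set w := Q.1 k k with hw
  set A := ∑ j ∈ Finset.univ.erase k, Q.1 j j with hA
  have hA0 : 0 ≤ A := Finset.sum_nonneg fun j _ => (Q.diag_pos j).le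
  set T := ∑ j, Q.inv.1 j j with hT
  have hT0 : 0 < T := Finset.sum_pos (fun j _ => Q.inv.diag_pos j) ⟨k, Finset.mem_univ k⟩
  set B := |Real.log T| with hB
  set L := Real.log s with hL
  have hL0 : 0 ≤ L := Real.log_nonneg (by linarith)
  set q := Real.log w with hq
  set D : ℝ := (|q| + L + A / w) ^ 2 + s * (s * B + |q| + L) ^ 2 with hD
  have upper : ∀ t > 0, PosForm.dist Q (spike hs k t) - t ≤
      s * a * (q + A / w * Real.exp (-(a * t))) + D / (2 * t) := by
    intro t ht
    obtain ⟨y, hy, hd, he, he', -⟩ := PosForm.exists_log_eigenvalues (by omega) Q (spike hs k t)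
    have hat : 0 < a * t := mul_pos ha ht
    have tr1 : ((spike hs k t).1⁻¹ * Q.1).trace =
        Real.exp ((s - 1) * a * t) * w + Real.exp (-(a * t)) * A := by
      rw [spike, PosForm.diagonal_inv_eq fun i => Real.exp_pos _, Matrix.trace,
        ← Finset.add_sum_erase _ _ (Finset.mem_univ k), hA, Finset.mul_sum]
      congr 1
      · simp [Real.exp_neg, ← ha_def, hw]
      · refine Finset.sum_congr rfl fun j hj => ?_
        simp [Matrix.diagonal_mul, Finset.ne_of_mem_erase hj, Real.exp_neg, ← ha_def]
    have tr2 : (Q.1⁻¹ * (spike hs k t).1).trace ≤ T * Real.exp (a * t) := by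
      rw [spike, Matrix.trace, hT, Finset.sum_mul]
      refine Finset.sum_le_sum fun j _ => ?_
      rw [Matrix.diag_apply, Matrix.mul_diagonal]
      refine mul_le_mul_of_nonneg_left (Real.exp_le_exp.mpr ?_) (Q.inv.diag_pos j).le
      split_ifs
      · nlinarith
      · exact le_rfl
    have : Nonempty (Fin s) := ⟨k⟩
    obtain ⟨j, hj⟩ := Finite.exists_max y
    have hlow : ∀ i, -(a * t) - B ≤ y i := by
      intro i
      have h1 : Real.exp (-y i) ≤ T * Real.exp (a * t) :=
        (Finset.single_le_sum (f := fun i => Real.exp (-y i)) (fun i _ => (Real.exp_pos _).le)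
          (Finset.mem_univ i)).trans (he'.le.trans tr2)
      have h2 : Real.exp (-y i) ≤ Real.exp (B + a * t) := by
        rw [Real.exp_add]
        refine h1.trans (mul_le_mul_of_nonneg_right ?_ (Real.exp_pos _).le)
        exact (Real.log_le_iff_le_exp hT0).mp (le_abs_self _)
      have := Real.exp_le_exp.mp h2
      linarith
    -- The largest of `s` exponentials is at least their average, hence the loss `L = log s`. This
    -- crude bound suffices, since `L` only enters the `O(1 / t)` term.
    have hj1 : (s - 1) * a * t + q - L ≤ y j := by
      have h1 : Real.exp ((s - 1) * a * t) * w ≤ s * Real.exp (y j) := by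
        calc _ ≤ ∑ i, Real.exp (y i) := by
              rw [he, tr1]
              exact le_add_of_nonneg_right (mul_nonneg (Real.exp_pos _).le hA0)
          _ ≤ Finset.univ.card • Real.exp (y j) :=
              Finset.sum_le_card_nsmul _ _ _ fun i _ => Real.exp_le_exp.mpr (hj i)
          _ = _ := by simp
      have h2 : Real.exp ((s - 1) * a * t + q) ≤ Real.exp (L + y j) := by
        rw [Real.exp_add, Real.exp_add, Real.exp_log hQ, Real.exp_log (by linarith)]
        exact h1
      have := Real.exp_le_exp.mp h2
      linarith
    -- Here the error must tend to zero, because it contributes to the limit; it comes from `1 + x ≤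
    -- exp x`.
    have hj2 : y j ≤ (s - 1) * a * t + q + A / w * Real.exp (-(a * t)) := by
      have h1 : Real.exp (y j) ≤ Real.exp ((s - 1) * a * t) * w + Real.exp (-(a * t)) * A := by
        rw [← tr1, ← he]
        exact Finset.single_le_sum (f := fun i => Real.exp (y i)) (fun i _ => (Real.exp_pos _).le)
          (Finset.mem_univ j)
      apply Real.exp_le_exp.mp
      refine h1.trans ?_
      rw [Real.exp_add, Real.exp_add, Real.exp_log hQ]
      have h2 := Real.add_one_le_exp (A / w * Real.exp (-(a * t)))
      have h3 : 1 ≤ Real.exp ((s - 1) * a * t) := Real.one_le_exp (by nlinarith)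
      calc _ ≤ Real.exp ((s - 1) * a * t) * w + Real.exp ((s - 1) * a * t) *
            (Real.exp (-(a * t)) * A) := by
            refine add_le_add le_rfl ?_
            exact le_mul_of_one_le_left (mul_nonneg (Real.exp_pos _).le hA0) h3
        _ = Real.exp ((s - 1) * a * t) * w * (A / w * Real.exp (-(a * t)) + 1) := by
            field_simp
            ring
        _ ≤ _ := mul_le_mul_of_nonneg_left h2 (by positivity)
    have hδ0 : 0 ≤ A / w * Real.exp (-(a * t)) := by positivity
    have hδ : |A / w * Real.exp (-(a * t))| ≤ A / w := by
      rw [abs_of_nonneg hδ0]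
      exact mul_le_of_le_one_right (by positivity) (Real.exp_le_one_iff.mpr (by linarith))
    have := sqrt_sum_sq_le ha ha1 hs ht hy (abs_nonneg _) hL0 hlow j hj1 hj2
    rw [hd]
    have h9 : ((|q| + L + |A / w * Real.exp (-(a * t))|) ^ 2 + s * (s * B + |q| + L) ^ 2) / (2 * t)
        ≤ D / (2 * t) := by
      rw [hD]
      gcongr
    linarith
  have lim : Tendsto (fun t => s * a * (q + A / w * Real.exp (-(a * t))) + D / (2 * t)) atTop
      (𝓝 (s * a * (q + A / w * 0) + 0)) := by
    refine ((tendsto_const_nhds.add (tendsto_const_nhds.mul ?_)).const_mul _).add ?_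
    · exact Real.tendsto_exp_neg_atTop_nhds_zero.comp (tendsto_id.const_mul_atTop ha)
    · exact (tendsto_id.const_mul_atTop (by norm_num : (0 : ℝ) < 2)).const_div_atTop D
  rw [mul_zero, add_zero, add_zero] at lim
  refine tendsto_of_tendsto_of_tendsto_of_le_of_le' tendsto_const_nhds lim
    (Eventually.of_forall fun t => ?_) ((eventually_gt_atTop 0).mono fun t ht => upper t ht)
  have := add_log_le_dist_spike hs Q k t
  linarith

/-! ### Integer vectors under `SL(s, ℤ)`. -/

theorem transvection_mulVec {ι : Type*} [Fintype ι] [DecidableEq ι] {i j : ι} (hij : i ≠ j) (b : ℤ)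
    (w : ι → ℤ) : (Matrix.SpecialLinearGroup.transvection hij b).1 *ᵥ w
      = w + Pi.single i (b * w j) := by
  rw [Matrix.SpecialLinearGroup.transvection_coe, Matrix.add_mulVec, Matrix.one_mulVec]
  congr 1
  funext k
  rw [Matrix.single_mulVec_eq]
  by_cases hk : k = i
  · subst hk; simp
  · simp [hk]

/-- Every non-zero integer vector is a multiple of a column of a matrix in `SL(s, ℤ)`. -/
theorem exists_eq_mulVec_single {s : ℕ} (j : Fin s) (v : Fin s → ℤ) (hv : v ≠ 0) :
    ∃ (γ : SL(s, ℤ)) (k : ℤ), k ≠ 0 ∧ v = γ.1 *ᵥ Pi.single j k := by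
  induction h : ∑ i, (v i).natAbs using Nat.strong_induction_on generalizing v with
  | _ N ih =>
  have step : ∀ i i' : Fin s, i ≠ i' → v i ≠ 0 → v i' ≠ 0 → (v i').natAbs ≤ (v i).natAbs →
      ∃ (γ : SL(s, ℤ)) (k : ℤ), k ≠ 0 ∧ v = γ.1 *ᵥ Pi.single j k := by
    intro i i' hii hi hi' hle
    -- A Euclidean step by plain subtraction: `ε` is the sign that brings the larger entry closer to
    -- zero.
    obtain ⟨ε, hε⟩ : ∃ ε : ℤ, (v i - ε * v i').natAbs < (v i).natAbs := by
      rcases lt_or_gt_of_ne hi with h1 | h1 <;> rcases lt_or_gt_of_ne hi' with h2 | h2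
      · exact ⟨1, by omega⟩
      · exact ⟨-1, by omega⟩
      · exact ⟨-1, by omega⟩
      · exact ⟨1, by omega⟩
    set w : Fin s → ℤ := v - Pi.single i (ε * v i') with hw
    have hwi : w i = v i - ε * v i' := by simp [hw]
    have hwne : ∀ k, k ≠ i → w k = v k := fun k hk => by simp [hw, hk]
    have hw0 : w ≠ 0 := fun h0 => hi' (by rw [← hwne i' hii.symm, h0]; rfl)
    have hlt : ∑ i, (w i).natAbs < N := by
      rw [← h]
      refine Finset.sum_lt_sum (fun k _ => ?_) ⟨i, Finset.mem_univ i, by rw [hwi]; exact hε⟩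
      by_cases hk : k = i
      · subst hk; rw [hwi]; exact hε.le
      · rw [hwne k hk]
    obtain ⟨γ, k, hk, hγ⟩ := ih _ hlt w hw0 rfl
    refine ⟨Matrix.SpecialLinearGroup.transvection hii ε * γ, k, hk, ?_⟩
    rw [Matrix.SpecialLinearGroup.coe_mul, ← Matrix.mulVec_mulVec, ← hγ, transvection_mulVec,
      hwne i' hii.symm, hw, sub_add_cancel]
  obtain ⟨i, hi⟩ := Function.ne_iff.mp hv
  by_cases hex : ∃ i', i ≠ i' ∧ v i' ≠ 0
  · obtain ⟨i', hii, hi'⟩ := hex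
    rcases le_total (v i').natAbs (v i).natAbs with hle | hle
    · exact step i i' hii hi hi' hle
    · exact step i' i hii.symm hi' hi hle
  · push Not at hex
    have hvi : v = Pi.single i (v i) := by
      funext k
      by_cases hk : k = i
      · subst hk; simp
      · simp [hk, hex k (Ne.symm hk)]
    by_cases hij : i = j
    · subst hij
      exact ⟨1, v i, hi, by rw [Matrix.SpecialLinearGroup.coe_one, Matrix.one_mulVec]; exact hvi⟩
    -- With `k = v i`, the two factors act by `k e_j ↦ k e_j + k e_i ↦ k e_i`.
    · refine ⟨Matrix.SpecialLinearGroup.transvection (Ne.symm hij) (-1) *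
        Matrix.SpecialLinearGroup.transvection hij 1, v i, hi, ?_⟩
      rw [Matrix.SpecialLinearGroup.coe_mul, ← Matrix.mulVec_mulVec, transvection_mulVec,
        transvection_mulVec]
      have hji : j ≠ i := Ne.symm hij
      funext k
      rw [hvi]
      by_cases hk : k = i
      · subst hk; simp [hij]
      · by_cases hk' : k = j
        · subst hk'; simp [hk]
        · simp [hk, hk', Pi.single_apply]

/-! ### The minimum of a form over the non-zero integer vectors. -/

namespace PosForm

variable {s : ℕ}

/-- The value of a form at an integer vector. -/
def intVal (Q : PosForm s) (v : Fin s → ℤ) : ℝ :=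
  (fun i => (v i : ℝ)) ⬝ᵥ Q.1 *ᵥ fun i => (v i : ℝ)

/-- The values of a form at the non-zero integer vectors. -/
def intValues (Q : PosForm s) : Set ℝ := {a | ∃ v : Fin s → ℤ, v ≠ 0 ∧ a = Q.intVal v}

theorem intVal_zero (Q : PosForm s) : Q.intVal 0 = 0 := by
  simp only [intVal, Pi.zero_apply, Int.cast_zero]
  exact zero_dotProduct _

theorem intVal_pos (Q : PosForm s) {v : Fin s → ℤ} (hv : v ≠ 0) : 0 < Q.intVal v := by
  have h : (fun i => (v i : ℝ)) ≠ 0 := by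
    intro h0
    apply hv
    funext i
    exact Int.cast_eq_zero.mp (congrFun h0 i)
  have := Q.2.1.dotProduct_mulVec_pos h
  simpa [intVal] using this

theorem intVal_act (Q : PosForm s) (γ : SL(s, ℤ)) (v : Fin s → ℤ) :
    (Q.act (Matrix.SpecialLinearGroup.map (Int.castRingHom ℝ) γ)).intVal v
      = Q.intVal (γ.1 *ᵥ v) := by
  have h : (fun i => ((γ.1 *ᵥ v) i : ℝ)) =
      (γ.1.map (Int.castRingHom ℝ)) *ᵥ fun i => (v i : ℝ) := by
    funext i
    simp [Matrix.mulVec, dotProduct]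
  unfold intVal
  rw [h]
  change _ ⬝ᵥ ((γ.1.map (Int.castRingHom ℝ))ᵀ * Q.1 * γ.1.map (Int.castRingHom ℝ)) *ᵥ _ = _
  rw [Matrix.mul_assoc, ← Matrix.mulVec_mulVec, ← Matrix.mulVec_mulVec,
    Matrix.dotProduct_mulVec, Matrix.vecMul_transpose]

theorem intVal_single (Q : PosForm s) (j : Fin s) (k : ℤ) :
    Q.intVal (Pi.single j k) = (k : ℝ) ^ 2 * Q.1 j j := by
  have h : (fun i => ((Pi.single j k : Fin s → ℤ) i : ℝ)) = Pi.single j (k : ℝ) := by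
    funext i
    by_cases hi : i = j
    · subst hi; simp
    · simp [hi]
  rw [intVal, h, single_dotProduct, Matrix.mulVec_single]
  simp
  ring

theorem intVal_ofSL (g : SL(s, ℝ)) (v : Fin s → ℤ) :
    (ofSL g).intVal v = ‖WithLp.toLp 2 (g.1 *ᵥ fun j => (v j : ℝ))‖ ^ 2 := by
  have h1 : (ofSL g).1 = g.1ᵀ * g.1 := by simp [ofSL, act]
  rw [intVal, h1, ← Matrix.mulVec_mulVec, Matrix.dotProduct_mulVec, Matrix.vecMul_transpose,
    EuclideanSpace.real_norm_sq_eq]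
  simp [dotProduct, sq]

/-- With `Q = gᵀ g`, recovering `v` from `g v` through `g⁻¹` and Cauchy–Schwarz bounds every
coordinate of `v`. -/
theorem finite_intVal_le (hs : 1 ≤ s) (Q : PosForm s) (R : ℝ) :
    {v : Fin s → ℤ | Q.intVal v ≤ R}.Finite := by
  obtain ⟨g, rfl⟩ := ofSL_surjective hs Q
  set h : Matrix (Fin s) (Fin s) ℝ := (g⁻¹).1 with hh
  have hg : h * g.1 = 1 := by
    rw [hh]
    exact_mod_cast congrArg Subtype.val (inv_mul_cancel g)
  obtain ⟨M, hM⟩ := exists_nat_ge ((∑ i, ∑ j, h i j ^ 2) * R)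
  refine (Set.finite_Icc (fun _ => -(M : ℤ)) (fun _ : Fin s => (M : ℤ))).subset fun v hv => ?_
  have bound : ∀ i, |v i| ≤ (M : ℤ) := by
    intro i
    set w := g.1 *ᵥ fun j => (v j : ℝ) with hw
    have h1 : (v i : ℝ) = ∑ j, h i j * w j := by
      have : h *ᵥ w = fun j => (v j : ℝ) := by
        rw [hw, Matrix.mulVec_mulVec, hg, Matrix.one_mulVec]
      exact (congrFun this i).symm
    have h2 : (v i : ℝ) ^ 2 ≤ (∑ j, h i j ^ 2) * ∑ j, w j ^ 2 := by
      rw [h1]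
      exact Finset.sum_mul_sq_le_sq_mul_sq _ _ _
    have h3 : ∑ j, w j ^ 2 ≤ R := by
      have : (ofSL g).intVal v ≤ R := hv
      rwa [intVal_ofSL, EuclideanSpace.real_norm_sq_eq] at this
    have h4 : ∑ j, h i j ^ 2 ≤ ∑ i, ∑ j, h i j ^ 2 :=
      Finset.single_le_sum (f := fun i => ∑ j, h i j ^ 2)
        (fun i _ => Finset.sum_nonneg fun j _ => sq_nonneg _) (Finset.mem_univ i)
    have h5 : (v i : ℝ) ^ 2 ≤ M := by
      refine h2.trans (le_trans ?_ hM)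
      exact mul_le_mul h4 h3 (Finset.sum_nonneg fun j _ => sq_nonneg _)
        (Finset.sum_nonneg fun i _ => Finset.sum_nonneg fun j _ => sq_nonneg _)
    have h6 : v i ^ 2 ≤ (M : ℤ) := by exact_mod_cast h5
    rw [← sq_abs] at h6
    exact (Int.le_self_sq _).trans h6
  exact ⟨fun i => (abs_le.mp (bound i)).1, fun i => (abs_le.mp (bound i)).2⟩

/-- The minimum of a form over the non-zero integer vectors. -/
noncomputable def minVal (Q : PosForm s) : ℝ := sInf Q.intValues

theorem isLeast_minVal (hs : 1 ≤ s) (Q : PosForm s) : IsLeast Q.intValues Q.minVal := by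
  have hne : (Pi.single ⟨0, hs⟩ 1 : Fin s → ℤ) ≠ 0 := by simp
  set v₀ : Fin s → ℤ := Pi.single ⟨0, hs⟩ 1
  obtain ⟨v, hv, hmin⟩ := Set.exists_min_image {v : Fin s → ℤ | Q.intVal v ≤ Q.intVal v₀ ∧ v ≠ 0}
    Q.intVal ((finite_intVal_le hs Q _).subset fun v hv => hv.1) ⟨v₀, le_rfl, hne⟩
  have hl : IsLeast Q.intValues (Q.intVal v) := by
    refine ⟨⟨v, hv.2, rfl⟩, ?_⟩
    rintro a ⟨w, hw, rfl⟩
    by_cases hle : Q.intVal w ≤ Q.intVal v₀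
    · exact hmin w ⟨hle, hw⟩
    · exact hv.1.trans (not_le.mp hle).le
  rwa [minVal, hl.csInf_eq]

theorem minVal_pos (hs : 1 ≤ s) (Q : PosForm s) : 0 < Q.minVal := by
  obtain ⟨v, hv, h⟩ := (isLeast_minVal hs Q).1
  rw [h]
  exact Q.intVal_pos hv

theorem minVal_le_intVal (hs : 1 ≤ s) (Q : PosForm s) {v : Fin s → ℤ} (hv : v ≠ 0) :
    Q.minVal ≤ Q.intVal v := (isLeast_minVal hs Q).2 ⟨v, hv, rfl⟩

theorem minVal_le_intVal_act (hs : 1 ≤ s) (Q : PosForm s) (γ : SL(s, ℤ)) {v : Fin s → ℤ}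
    (hv : v ≠ 0) :
    Q.minVal ≤ (Q.act (Matrix.SpecialLinearGroup.map (Int.castRingHom ℝ) γ)).intVal v := by
  have h := intVal_pos (Q.act (Matrix.SpecialLinearGroup.map (Int.castRingHom ℝ) γ)) hv
  rw [intVal_act] at h ⊢
  refine minVal_le_intVal hs Q fun h0 => ?_
  rw [h0, intVal_zero] at h
  exact lt_irrefl _ h

theorem minVal_le_act_diag (Q : PosForm s) (γ : SL(s, ℤ)) (j : Fin s) :
    Q.minVal ≤ (Q.act (Matrix.SpecialLinearGroup.map (Int.castRingHom ℝ) γ)).1 j j := by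
  have h := minVal_le_intVal_act (Nat.one_le_iff_ne_zero.mpr fun h => by subst h; exact j.elim0)
    Q γ (v := Pi.single j 1) (by simp)
  rw [intVal_single] at h
  simpa using h

/-- A minimal vector is `k` times the `j`-th column of some `γ`. Since `k ^ 2 ≥ 1`, that column has
no larger value, so it is minimal too. -/
theorem exists_act_diag_eq_minVal (Q : PosForm s) (j : Fin s) : ∃ γ : SL(s, ℤ),
    (Q.act (Matrix.SpecialLinearGroup.map (Int.castRingHom ℝ) γ)).1 j j = Q.minVal := by
  have hs : 1 ≤ s := Nat.one_le_iff_ne_zero.mpr fun h => by subst h; exact j.elim0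
  obtain ⟨v, hv, hm⟩ := (isLeast_minVal hs Q).1
  obtain ⟨γ, k, hk, rfl⟩ := exists_eq_mulVec_single j v hv
  refine ⟨γ, le_antisymm ?_ (minVal_le_act_diag Q γ j)⟩
  rw [hm, ← intVal_act, intVal_single]
  refine le_mul_of_one_le_left (diag_pos _ j).le ?_
  have : 1 ≤ k ^ 2 := Int.add_one_le_iff.mpr (show 0 < k ^ 2 by positivity)
  exact_mod_cast this

theorem act_map_inv_transpose (Q : PosForm s) (γ : SL(s, ℤ)) :
    (Q.act (Matrix.SpecialLinearGroup.map (Int.castRingHom ℝ) γ)).inv =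
      Q.inv.act (Matrix.SpecialLinearGroup.map (Int.castRingHom ℝ) γ⁻¹.transpose) := by
  rw [inv_act, ← map_inv]
  rfl

theorem exists_inv_act_diag_eq_minVal (Q : PosForm s) (j : Fin s) : ∃ γ : SL(s, ℤ),
    (Q.act (Matrix.SpecialLinearGroup.map (Int.castRingHom ℝ) γ)).inv.1 j j = Q.inv.minVal := by
  obtain ⟨γ, h⟩ := exists_act_diag_eq_minVal Q.inv j
  refine ⟨γ.transpose⁻¹, ?_⟩
  rw [act_map_inv_transpose, _root_.inv_inv]
  exact h

end PosForm

/-! ### The quotient distance and the limit in `𝒯_s`. -/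

theorem proj_act {s : ℕ} (Q : PosForm s) (γ : SL(s, ℤ)) :
    proj (Q.act (Matrix.SpecialLinearGroup.map (Int.castRingHom ℝ) γ)) = proj Q :=
  Quotient.sound ⟨γ, rfl⟩

namespace LocSymSpace

variable {s : ℕ}

theorem dist_proj_le (Q R : PosForm s) (γ : SL(s, ℤ)) : dist (proj Q) (proj R) ≤
    PosForm.dist (Q.act (Matrix.SpecialLinearGroup.map (Int.castRingHom ℝ) γ)) R := by
  refine csInf_le ⟨0, ?_⟩ ⟨_, _, proj_act Q γ, rfl, rfl⟩
  rintro d ⟨Q', R', -, -, rfl⟩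
  exact PosForm.dist_nonneg _ _

/-- By invariance of the distance, a pair of representatives can be moved so that the second one is
`R` itself. -/
theorem le_dist_proj (hs : 1 ≤ s) (Q R : PosForm s) {b : ℝ} (h : ∀ γ : SL(s, ℤ),
    b ≤ PosForm.dist (Q.act (Matrix.SpecialLinearGroup.map (Int.castRingHom ℝ) γ)) R) :
    b ≤ dist (proj Q) (proj R) := by
  refine le_csInf ⟨_, Q, R, rfl, rfl, rfl⟩ ?_
  rintro d ⟨Q', R', hQ, hR, rfl⟩
  obtain ⟨γ, rfl⟩ := Quotient.exact hQ
  obtain ⟨δ, rfl⟩ := Quotient.exact hR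
  rw [← PosForm.dist_act hs _ _ (Matrix.SpecialLinearGroup.map (Int.castRingHom ℝ) δ⁻¹),
    PosForm.act_act, PosForm.act_act, ← map_mul, ← map_mul, mul_inv_cancel, map_one,
    PosForm.act_one]
  exact h _

theorem dist_proj_inv_le (hs : 1 ≤ s) (Q R : PosForm s) :
    dist (proj Q.inv) (proj R.inv) ≤ dist (proj Q) (proj R) := by
  refine le_dist_proj hs Q R fun γ => ?_
  rw [← PosForm.dist_inv hs, PosForm.act_map_inv_transpose]
  exact dist_proj_le _ _ _

theorem dist_proj_inv (hs : 1 ≤ s) (Q R : PosForm s) :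
    dist (proj Q.inv) (proj R.inv) = dist (proj Q) (proj R) := by
  refine le_antisymm (dist_proj_inv_le hs Q R) ?_
  have := dist_proj_inv_le hs Q.inv R.inv
  rwa [PosForm.inv_inv, PosForm.inv_inv] at this

/-- A single `γ` that realizes the minimum gives the upper bound for all `t`; the lower bound is
uniform over all `γ`, so infimum and limit can be exchanged. -/
theorem tendsto_dist_proj_spike_sub (hs : 2 ≤ s) (Q : PosForm s) (k : Fin s) :
    Tendsto (fun t => dist (proj Q) (proj (spike hs k t)) - t) atTop
      (𝓝 (s * slope s * Real.log Q.minVal)) := by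
  obtain ⟨γ, hγ⟩ := Q.exists_act_diag_eq_minVal k
  have upper := tendsto_dist_spike_sub hs
    (Q.act (Matrix.SpecialLinearGroup.map (Int.castRingHom ℝ) γ)) k
  rw [hγ] at upper
  refine tendsto_of_tendsto_of_tendsto_of_le_of_le tendsto_const_nhds upper (fun t => ?_)
    fun t => sub_le_sub_right (dist_proj_le Q _ γ) t
  rw [le_sub_iff_add_le]
  refine le_dist_proj (by omega) Q _ fun δ => ?_
  refine le_trans ?_ (add_log_le_dist_spike hs _ k t)
  rw [add_comm]
  refine add_le_add le_rfl (mul_le_mul_of_nonneg_left ?_ ?_)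
  · exact Real.log_le_log (Q.minVal_pos (by omega)) (Q.minVal_le_act_diag δ k)
  · exact mul_nonneg (Nat.cast_nonneg s) (slope_pos hs).le

end LocSymSpace

/-! ### The two extreme rays as spikes. -/

theorem singularRay_one_eq {s : ℕ} (hs : 2 ≤ s) (h1 : 1 < s) (k : Fin s) (hk : (k : ℕ) + 1 = s)
    (t : ℝ) : singularRay s 1 le_rfl h1 t = spike hs k t := by
  apply Subtype.ext
  simp only [singularRay, spike]
  congr 1
  funext j
  by_cases hj : (j : ℕ) < s - 1
  · have hj' : j ≠ k := fun h => by rw [h] at hj; omega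
    rw [if_pos hj, if_neg hj', Nat.cast_one, slope]
  · have hj' : j = k := Fin.ext (by have := j.2; omega)
    rw [if_neg hj, if_pos hj', sub_one_mul_slope hs, Nat.cast_one, mul_one, neg_mul]

theorem singularRay_sub_one_eq {s : ℕ} (hs : 2 ≤ s) (h0 : 1 ≤ s - 1) (h1 : s - 1 < s) (k : Fin s)
    (hk : (k : ℕ) = 0) (t : ℝ) : (singularRay s (s - 1) h0 h1 t).inv = spike hs k t := by
  apply Subtype.ext
  simp only [singularRay, spike, PosForm.inv]
  rw [PosForm.diagonal_inv_eq fun i => by split_ifs <;> exact Real.exp_pos _]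
  congr 1
  funext j
  have e1 : s - (s - 1) = 1 := by omega
  have e2 : ((s - 1 : ℕ) : ℝ) = s - 1 := by rw [Nat.cast_sub (by omega), Nat.cast_one]
  have e3 : (s : ℝ) - (s - 1) = 1 := by ring
  rw [e1, e2, e3]
  by_cases hj : (j : ℕ) < 1
  · have hj' : j = k := Fin.ext (by omega)
    rw [if_pos hj, if_pos hj', sub_one_mul_slope hs, mul_one, ← Real.exp_neg]
  · have hj' : j ≠ k := fun h => by rw [h] at hj; omega
    rw [if_neg hj, if_neg hj', slope, ← Real.exp_neg, neg_mul, neg_neg]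

theorem tendsto_fbar_one {s : ℕ} (hs : 2 ≤ s) (h1 : 1 < s) (Q : PosForm s) :
    Tendsto (fun t => LocSymSpace.dist (proj Q) (projRay s 1 le_rfl h1 t) - t) atTop
      (𝓝 (s * slope s * Real.log Q.minVal)) := by
  obtain ⟨k, hk⟩ : ∃ k : Fin s, (k : ℕ) + 1 = s := ⟨⟨s - 1, by omega⟩, Nat.sub_add_cancel h1.le⟩
  simp only [projRay, singularRay_one_eq hs h1 k hk]
  exact LocSymSpace.tendsto_dist_proj_spike_sub hs Q k

theorem tendsto_fbar_sub_one {s : ℕ} (hs : 2 ≤ s) (h0 : 1 ≤ s - 1) (h1 : s - 1 < s)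
    (Q : PosForm s) :
    Tendsto (fun t => LocSymSpace.dist (proj Q) (projRay s (s - 1) h0 h1 t) - t) atTop
      (𝓝 (s * slope s * Real.log Q.inv.minVal)) := by
  obtain ⟨k, hk⟩ : ∃ k : Fin s, (k : ℕ) = 0 := ⟨⟨0, by omega⟩, rfl⟩
  have h : ∀ t, LocSymSpace.dist (proj Q) (projRay s (s - 1) h0 h1 t) =
      LocSymSpace.dist (proj Q.inv) (proj (spike hs k t)) := fun t => by
    rw [projRay, ← LocSymSpace.dist_proj_inv (by omega), singularRay_sub_one_eq hs h0 h1 k hk]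
  simp only [h]
  exact LocSymSpace.tendsto_dist_proj_spike_sub hs Q.inv k

/-! ### Minkowski's theorem and Hermite's inequality. -/

open MeasureTheory in
/-- Minkowski's theorem for a box: the columns of an invertible matrix `B` have a non-trivial
integer combination whose coordinates are at most `|det B|^{1/n}` in absolute value. -/
theorem exists_abs_mulVec_le {n : ℕ} (hn : 1 ≤ n) (B : Matrix (Fin n) (Fin n) ℝ) (hB : B.det ≠ 0)
    {r : ℝ} (hr : 0 ≤ r) (hrn : r ^ n = |B.det|) :
    ∃ v : Fin n → ℤ, v ≠ 0 ∧ ∀ i, |(B *ᵥ fun j => (v j : ℝ)) i| ≤ r := by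
  have : Nonempty (Fin n) := ⟨⟨0, hn⟩⟩
  have hBu : IsUnit Bᵀ := (Matrix.isUnit_iff_isUnit_det _).mpr
    (by rw [Matrix.det_transpose]; exact isUnit_iff_ne_zero.mpr hB)
  obtain ⟨b, hb⟩ : ∃ b : Module.Basis (Fin n) ℝ (Fin n → ℝ), ⇑b = Bᵀ.row :=
    ⟨basisOfLinearIndependentOfCardEqFinrank (Matrix.linearIndependent_rows_of_isUnit hBu)
      (by simp), coe_basisOfLinearIndependentOfCardEqFinrank _ _⟩
  have hvol : volume (ZSpan.fundamentalDomain b) = ENNReal.ofReal |B.det| := by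
    rw [ZSpan.volume_fundamentalDomain, hb]
    congr 2
    exact Matrix.det_transpose B
  have : Countable (Submodule.span ℤ (Set.range b)).toAddSubgroup := by
    change Countable (Submodule.span ℤ (Set.range b))
    infer_instance
  -- The sup-norm ball of radius `r` has volume `(2 r)^n = 2^n |det B|`, exactly Minkowski's
  -- threshold; equality is allowed because the ball is compact.
  obtain ⟨⟨x, hx⟩, hx0, hmem⟩ := exists_ne_zero_mem_lattice_of_measure_mul_two_pow_le_measure
    (ZSpan.isAddFundamentalDomain' b volume) (s := Metric.closedBall (0 : Fin n → ℝ) r)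
    (fun x hx => by simpa using hx) (convex_closedBall _ _) (isCompact_closedBall _ _) (by
      rw [hvol, Real.volume_pi_closedBall _ hr, Module.finrank_fin_fun, Fintype.card_fin, mul_pow,
        hrn, mul_comm, ENNReal.ofReal_mul (by positivity), ENNReal.ofReal_pow (by norm_num)]
      simp)
  have hx' : x ∈ Submodule.span ℤ (Set.range b) := hx
  obtain ⟨c, hc⟩ := (Submodule.mem_span_range_iff_exists_fun ℤ).mp hx'
  have hxc : x = B *ᵥ fun j => (c j : ℝ) := by
    rw [← hc, hb]
    funext i
    simp [Matrix.mulVec, dotProduct, Finset.sum_apply, Matrix.row, mul_comm]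
  refine ⟨c, ?_, fun i => ?_⟩
  · rintro rfl
    apply hx0
    apply Subtype.ext
    change x = 0
    rw [← hc]
    simp
  · rw [← hxc, ← Real.norm_eq_abs]
    exact (norm_le_pi_norm x i).trans (by simpa using hmem)

open scoped MatrixOrder in
/-- Hermite's inequality, with Minkowski's constant for a box. -/
theorem exists_intVec_pow_le_det {n : ℕ} (hn : 1 ≤ n) (N : Matrix (Fin n) (Fin n) ℝ)
    (hN : N.PosDef) : ∃ v : Fin n → ℤ, v ≠ 0 ∧
      ((fun i => (v i : ℝ)) ⬝ᵥ N *ᵥ fun i => (v i : ℝ)) ^ n ≤ (n : ℝ) ^ n * N.det := by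
  obtain ⟨B, rfl⟩ := CStarAlgebra.nonneg_iff_eq_star_mul_self.mp hN.posSemidef.nonneg
  rw [Matrix.star_eq_conjTranspose, Matrix.conjTranspose_eq_transpose_of_trivial] at hN ⊢
  have hdet : (Bᵀ * B).det = B.det ^ 2 := by rw [Matrix.det_mul, Matrix.det_transpose, sq]
  have hB : B.det ≠ 0 := by
    have := hN.det_pos
    rw [hdet] at this
    exact fun h => by simp [h] at this
  have hrn : (|B.det| ^ (1 / (n : ℝ))) ^ n = |B.det| := by
    rw [one_div, Real.rpow_inv_natCast_pow (abs_nonneg _) (by omega)]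
  obtain ⟨v, hv, hbd⟩ := exists_abs_mulVec_le hn B hB (Real.rpow_nonneg (abs_nonneg _) _) hrn
  set r := |B.det| ^ (1 / (n : ℝ))
  refine ⟨v, hv, ?_⟩
  rw [← Matrix.mulVec_mulVec, Matrix.dotProduct_mulVec, Matrix.vecMul_transpose]
  set w := B *ᵥ fun j => (v j : ℝ)
  have h1 : w ⬝ᵥ w ≤ n * r ^ 2 := by
    calc w ⬝ᵥ w = ∑ i, |w i| ^ 2 := by simp [dotProduct, sq]
      _ ≤ Finset.univ.card • r ^ 2 := Finset.sum_le_card_nsmul _ _ _ fun i _ =>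
          pow_le_pow_left₀ (abs_nonneg _) (hbd i) 2
      _ = _ := by simp
  have h0 : 0 ≤ w ⬝ᵥ w := Finset.sum_nonneg fun i _ => mul_self_nonneg _
  calc (w ⬝ᵥ w) ^ n ≤ (n * r ^ 2) ^ n := pow_le_pow_left₀ h0 h1 n
    _ = n ^ n * (r ^ n) ^ 2 := by ring
    _ = _ := by rw [hrn, sq_abs, hdet]

/-! ### Duality: minima, hyperplane sublattices and covolumes. -/

namespace PosForm

theorem det_submatrix_succ {n : ℕ} (Q : PosForm (n + 1)) :
    (Q.1.submatrix Fin.succ Fin.succ).det = Q.inv.1 0 0 := by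
  have h := Matrix.adjugate_fin_succ_eq_det_submatrix Q.1 0 0
  rw [inv_val_eq_adjugate]
  simpa using h.symm

/-- The minimum of a form is bounded in terms of the minimum of the dual form. -/
theorem minVal_pow_le {n : ℕ} (hn : 1 ≤ n) (Q : PosForm (n + 1)) :
    Q.minVal ^ n ≤ (n : ℝ) ^ n * Q.inv.minVal := by
  -- After this change of basis, the restriction to the last `n` coordinates has determinant equal
  -- to the minimum of the dual form.
  obtain ⟨γ, hγ⟩ := Q.exists_inv_act_diag_eq_minVal 0
  set R := Q.act (Matrix.SpecialLinearGroup.map (Int.castRingHom ℝ) γ) with hR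
  obtain ⟨v, hv, hle⟩ := exists_intVec_pow_le_det hn _
    (R.2.1.submatrix (Fin.succ_injective n))
  rw [det_submatrix_succ, hγ] at hle
  refine le_trans (pow_le_pow_left₀ (minVal_pos (by omega) Q).le ?_ n) hle
  have hv' : (Fin.cons 0 v : Fin (n + 1) → ℤ) ≠ 0 := by
    intro h
    apply hv
    funext i
    simpa using congrFun h i.succ
  have h := minVal_le_intVal_act (by omega) Q γ hv'
  rw [← hR] at h
  refine h.trans (le_of_eq ?_)
  simp [intVal, dotProduct, Matrix.mulVec, Fin.sum_univ_succ]

/-- The Gram determinant of `n` integer vectors of `ℝ ^ (n + 1)` is the value of the dual form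
at their cross product. -/
theorem det_gram_eq_intVal_inv {n : ℕ} (g : SL(n + 1, ℝ)) (v : Fin n → Fin (n + 1) → ℤ)
    (A : Matrix (Fin (n + 1)) (Fin (n + 1)) ℤ) (hA : ∀ i, A i.succ = v i) :
    (Matrix.gram ℝ fun i => (WithLp.toLp 2 (g.1 *ᵥ fun j => (v i j : ℝ)) :
      EuclideanSpace ℝ (Fin (n + 1)))).det = (ofSL g).inv.intVal fun i => A.adjugate i 0 := by
  set Q := ofSL g with hQ
  have hQ1 : Q.1 = g.1ᵀ * g.1 := by simp [hQ, ofSL, act]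
  set A' := A.map (Int.castRingHom ℝ) with hA'
  have hgram : (Matrix.gram ℝ fun i => (WithLp.toLp 2 (g.1 *ᵥ fun j => (v i j : ℝ)) :
      EuclideanSpace ℝ (Fin (n + 1)))) = (A' * Q.1 * A'ᵀ).submatrix Fin.succ Fin.succ := by
    have hrow : ∀ i : Fin n, A' i.succ = fun j => (v i j : ℝ) := fun i => by
      funext j
      simp [hA', hA]
    ext i j
    have h1 : (A' * Q.1 * A'ᵀ) i.succ j.succ = A' i.succ ⬝ᵥ Q.1 *ᵥ A' j.succ := by
      rw [Matrix.mul_assoc, Matrix.mul_apply']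
      congr 1
    rw [Matrix.submatrix_apply, h1, hQ1, ← Matrix.mulVec_mulVec, Matrix.dotProduct_mulVec,
      Matrix.vecMul_transpose, hrow, hrow, Matrix.gram_apply, EuclideanSpace.inner_eq_star_dotProduct]
    simp [dotProduct_comm]
  have hadj := Matrix.adjugate_fin_succ_eq_det_submatrix (A' * Q.1 * A'ᵀ) 0 0
  -- Only column `0` of `A.adjugate` matters: it consists of the cofactors along row `0`, so it does
  -- not depend on that row.
  have h2 : (A' * Q.1 * A'ᵀ).adjugate = A'.adjugateᵀ * (Q.inv.1 * A'.adjugate) := by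
    rw [Matrix.adjugate_mul_distrib, Matrix.adjugate_mul_distrib, inv_val_eq_adjugate,
      Matrix.adjugate_transpose]
  have h3 : A'.adjugate = A.adjugate.map (Int.castRingHom ℝ) :=
    ((Int.castRingHom ℝ).map_adjugate A).symm
  rw [hgram]
  simp only [Fin.val_zero, add_zero, pow_zero, one_mul, Fin.succAbove_zero] at hadj
  rw [← hadj, h2, h3]
  rfl

theorem isLeast_nonzeroNorms {s : ℕ} (hs : 1 ≤ s) (g : SL(s, ℝ)) :
    IsLeast (nonzeroNorms (lattice g)) (Real.sqrt (ofSL g).minVal) := by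
  have hsqrt : ∀ v : Fin s → ℤ, Real.sqrt ((ofSL g).intVal v) =
      ‖WithLp.toLp 2 (g.1 *ᵥ fun j => (v j : ℝ))‖ := fun v => by
    rw [intVal_ofSL, Real.sqrt_sq (norm_nonneg _)]
  constructor
  · obtain ⟨v, hv, hm⟩ := (isLeast_minVal hs (ofSL g)).1
    refine ⟨_, ⟨v, rfl⟩, ?_, by rw [hm, hsqrt]⟩
    intro h0
    have h1 := intVal_pos (ofSL g) hv
    rw [intVal_ofSL, h0] at h1
    simp at h1
  · rintro a ⟨w, ⟨v, rfl⟩, hw, rfl⟩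
    rw [← hsqrt]
    refine Real.sqrt_le_sqrt (minVal_le_intVal hs _ ?_)
    rintro rfl
    apply hw
    have : (fun j => (((0 : Fin s → ℤ) j : ℤ) : ℝ)) = 0 := by funext j; simp
    rw [this, Matrix.mulVec_zero]
    rfl

theorem isLeast_hyperplaneCovolumes {s : ℕ} (hs : 1 ≤ s) (g : SL(s, ℝ)) :
    IsLeast (hyperplaneCovolumes (lattice g)) (Real.sqrt (ofSL g).inv.minVal) := by
  obtain ⟨n, rfl⟩ : ∃ n, s = n + 1 := ⟨s - 1, by omega⟩
  change IsLeast {a | ∃ w : Fin n → EuclideanSpace ℝ (Fin (n + 1)), (∀ i, w i ∈ lattice g) ∧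
    LinearIndependent ℝ w ∧ a = Real.sqrt (Matrix.gram ℝ w).det} _
  constructor
  -- The columns of `γ` other than the first span the sublattice sought: their cross product is the
  -- first column of the inverse transpose of `γ`, a minimal vector of the dual form.
  · obtain ⟨γ, hγ⟩ := (ofSL g).exists_inv_act_diag_eq_minVal 0
    have key := det_gram_eq_intVal_inv g (fun i => γ.1.transpose i.succ) γ.1.transpose fun _ => rfl
    have hval : ((ofSL g).inv.intVal fun i => γ.1.transpose.adjugate i 0) =
        (ofSL g).inv.minVal := by
      rw [← hγ, act_map_inv_transpose]
      have h := intVal_single ((ofSL g).inv.act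
        (Matrix.SpecialLinearGroup.map (Int.castRingHom ℝ) γ⁻¹.transpose)) 0 1
      rw [intVal_act] at h
      simp only [Int.cast_one, one_pow, one_mul] at h
      rw [← h]
      congr 1
      funext i
      rw [Matrix.mulVec_single_one]
      change γ.1ᵀ.adjugate i 0 = (γ⁻¹).1ᵀ i 0
      rw [Matrix.SpecialLinearGroup.coe_inv, Matrix.adjugate_transpose]
    rw [hval] at key
    refine ⟨_, fun i => ⟨γ.1.transpose i.succ, rfl⟩, ?_, by rw [key]⟩
    apply Matrix.linearIndependent_of_det_gram_ne_zero
    rw [key]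
    exact (minVal_pos hs _).ne'
  · rintro a ⟨w, hw, hli, rfl⟩
    choose v hv using hw
    obtain rfl : w = _ := funext hv
    have hpos := (Matrix.posDef_gram_of_linearIndependent hli).det_pos
    -- Row `0` is an arbitrary filler. The Gram determinant is positive by independence, so the
    -- cross product is non-zero and competes for the dual minimum.
    rw [det_gram_eq_intVal_inv g v (Fin.cons 0 v) fun _ => rfl] at hpos ⊢
    refine Real.sqrt_le_sqrt (minVal_le_intVal hs _ fun h0 => ?_)
    rw [h0, intVal_zero] at hpos
    exact lt_irrefl _ hpos

/-- The logarithmic form of the comparison between the minima of a form and of its dual. -/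
theorem log_minVal_le {s : ℕ} (hs : 2 ≤ s) (Q : PosForm s) :
    ((s : ℝ) - 1) * Real.log Q.minVal ≤
      (s - 1) * Real.log (s - 1) + Real.log Q.inv.minVal := by
  obtain ⟨n, rfl⟩ : ∃ n, s = n + 1 := ⟨s - 1, by omega⟩
  have hn : 1 ≤ n := by omega
  have hn' : (0 : ℝ) < n := by exact_mod_cast hn
  have h := Real.log_le_log (pow_pos (minVal_pos (by omega) Q) n) (minVal_pow_le hn Q)
  rw [Real.log_mul (pow_pos hn' n).ne' (minVal_pos (by omega) _).ne', Real.log_pow,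
    Real.log_pow] at h
  simpa using h

end PosForm

end LocSym

theorem proposition2p5p2 (s : ℕ) (hs : 2 ≤ s) :
    -- the limits that define the two Busemann functions exist
    (∀ x : LocSym.LocSymSpace s,
      Tendsto (fun t : ℝ =>
          LocSym.LocSymSpace.dist x (LocSym.projRay s 1 le_rfl (by omega) t) - t) atTop
        (𝓝 (LocSym.fbar s 1 le_rfl (by omega) x)) ∧
      Tendsto (fun t : ℝ =>
          LocSym.LocSymSpace.dist x (LocSym.projRay s (s - 1) (by omega) (by omega) t) - t) atTop
        (𝓝 (LocSym.fbar s (s - 1) (by omega) (by omega) x))) ∧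
    -- the comparison
    (∃ C : ℝ, ∀ x : LocSym.LocSymSpace s,
      ((s : ℝ) - 1) * LocSym.fbar s (s - 1) (by omega) (by omega) x - C
          ≤ LocSym.fbar s 1 le_rfl (by omega) x ∧
      LocSym.fbar s 1 le_rfl (by omega) x
          ≤ 1 / ((s : ℝ) - 1) * LocSym.fbar s (s - 1) (by omega) (by omega) x + C) ∧
    -- the two functions in terms of lattices
    (∀ g : Matrix.SpecialLinearGroup (Fin s) ℝ, ∃ m c : ℝ, 0 < m ∧ 0 < c ∧
      IsLeast (LocSym.nonzeroNorms (LocSym.lattice g)) m ∧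
      IsLeast (LocSym.hyperplaneCovolumes (LocSym.lattice g)) c ∧
      LocSym.fbar s 1 le_rfl (by omega) (LocSym.proj (LocSym.PosForm.ofSL g))
        = 2 * Real.sqrt ((s : ℝ) / ((s : ℝ) - 1)) * Real.log m ∧
      LocSym.fbar s (s - 1) (by omega) (by omega) (LocSym.proj (LocSym.PosForm.ofSL g))
        = 2 * Real.sqrt ((s : ℝ) / ((s : ℝ) - 1)) * Real.log c) := by
  have hs' : (2 : ℝ) ≤ s := by exact_mod_cast hs
  have lim₁ := fun Q => LocSym.tendsto_fbar_one hs (by omega) Q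
  have lim₂ := fun Q => LocSym.tendsto_fbar_sub_one hs (by omega) (by omega) Q
  have f₁ : ∀ Q : LocSym.PosForm s, LocSym.fbar s 1 le_rfl (by omega) (LocSym.proj Q) =
      s * LocSym.slope s * Real.log Q.minVal := fun Q => (lim₁ Q).limUnder_eq
  have f₂ : ∀ Q : LocSym.PosForm s,
      LocSym.fbar s (s - 1) (by omega) (by omega) (LocSym.proj Q) =
      s * LocSym.slope s * Real.log Q.inv.minVal := fun Q => (lim₂ Q).limUnder_eq
  have ha : 0 < s * LocSym.slope s := mul_pos (by linarith) (LocSym.slope_pos hs)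
  have hs1 : (0 : ℝ) < s - 1 := by linarith
  have hlog : 0 ≤ Real.log ((s : ℝ) - 1) := Real.log_nonneg (by linarith)
  -- The constant is dictated by the lower estimate; the upper one needs only `s a log (s - 1)`,
  -- which is smaller because `s - 1 ≥ 1`.
  refine ⟨fun x => ?_, ⟨s * LocSym.slope s * ((s - 1) * Real.log (s - 1)), fun x => ?_⟩,
    fun g => ?_⟩
  · obtain ⟨Q, rfl⟩ : ∃ Q, LocSym.proj Q = x := Quotient.exists_rep x
    rw [f₁, f₂]
    exact ⟨lim₁ Q, lim₂ Q⟩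
  · obtain ⟨Q, rfl⟩ : ∃ Q, LocSym.proj Q = x := Quotient.exists_rep x
    rw [f₁, f₂]
    have h1 := Q.log_minVal_le hs
    have h2 := Q.inv.log_minVal_le hs
    rw [LocSym.PosForm.inv_inv] at h2
    constructor
    · have := mul_le_mul_of_nonneg_left h2 ha.le
      linarith
    · have h3 : Real.log Q.minVal ≤ 1 / ((s : ℝ) - 1) * Real.log Q.inv.minVal +
          (s - 1) * Real.log (s - 1) := by
        have h4 : Real.log Q.minVal ≤ 1 / ((s : ℝ) - 1) * Real.log Q.inv.minVal +
            Real.log (s - 1) := by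
          have h5 := mul_le_mul_of_nonneg_left h1 (one_div_pos.mpr hs1).le
          have h6 : 1 / ((s : ℝ) - 1) * (s - 1) = 1 := one_div_mul_cancel hs1.ne'
          linear_combination h5 + (Real.log (s - 1) - Real.log Q.minVal) * h6
        have : 1 * Real.log ((s : ℝ) - 1) ≤ (s - 1) * Real.log (s - 1) :=
          mul_le_mul_of_nonneg_right (by linarith) hlog
        linarith
      have := mul_le_mul_of_nonneg_left h3 ha.le
      linarith
  · have hm := LocSym.PosForm.minVal_pos (by omega) (LocSym.PosForm.ofSL g)
    have hc := LocSym.PosForm.minVal_pos (by omega) (LocSym.PosForm.ofSL g).inv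
    refine ⟨_, _, Real.sqrt_pos.mpr hm, Real.sqrt_pos.mpr hc,
      LocSym.PosForm.isLeast_nonzeroNorms (by omega) g,
      LocSym.PosForm.isLeast_hyperplaneCovolumes (by omega) g, ?_, ?_⟩
    · rw [f₁, LocSym.mul_slope hs, Real.log_sqrt hm.le]
      ring
    · rw [f₂, LocSym.mul_slope hs, Real.log_sqrt hc.le]
      ring
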